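/- Let $(\Omega,\mu)$ be a $\sigma$-finite non-atomic measure space and let $\mathcal M(\Omega,\mu)$ be the set of (classes of $\mu$-a.e. equal) real- or complex-valued $\mu$-measurable functions on $\Omega$. For $f\in\mathcal M(\Omega,\mu)$ and $t>0$ put $f^*(t)=\inf\{\lambda\ge 0:\mu\{|f|>\lambda\}\le t\}$ and $f^{**}(t)=\frac1t\int_0^t f^*(u)\,du$ (values in $[0,\infty]$). The space $L_{1,\infty}$ consists of all $f$ with $\|f\|_{L_{1,\infty}}=\sup_{t>0}tf^*(t)<\infty$. For quasi-normed spaces $A_0,A_1\subset\mathcal M(\Omega,\mu)$ and $f\in A_0+A_1$ let $$K(t,f;A_0,A_1)=\inf\{\|f_0\|_{A_0}+t\|f_1\|_{A_1}: f=f_0+f_1,\ f_i\in A_i\},\qquad t>0.$$ A positive Lebesgue measurable function $b$ on $(0,\infty)$ is slowly varying, $b\in SV$, if for every $\varepsilon>0$ the function $t^{\varepsilon}b(t)$ is equivalent (up to positive multiplicative constants) to a non-decreasing function and $t^{-\varepsilon}b(t)$ is equivalent to a non-increasing function. Denote by $\|\cdot\|_{q,I}$ the usual (quasi-)norm of $L_q$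 on the interval $I$ with respect to Lebesgue measure, and put $1/\infty=0$, $1/0=\infty$. For $\alpha\in\mathbb R$, $0<q,r,s\le\infty$, $a,b,c\in SV$ and a measurable function $\varphi:(0,\infty)\to[0,\infty]$ let $$N^{\mathcal R,\mathcal L}_{\alpha}(\varphi)=\bigg\|t^{-\frac1s}c(t)\Big\|u^{-\frac1r}b(u)\big\|v^{\alpha-\frac1q}a(v)\varphi(v)\big\|_{q,(u,t)}\Big\|_{r,(0,t)}\bigg\|_{s,(0,\infty)},$$ $$N^{\mathcal L,\mathcal R}_{\alpha}(\varphi)=\bigg\|t^{-\frac1s}c(t)\Big\|u^{-\frac1r}b(u)\big\|v^{\alpha-\frac1q}a(v)\varphi(v)\big\|_{q,(t,u)}\Big\|_{r,(t,\infty)}\bigg\|_{s,(0,\infty)}.$$ For $\mathcal X\in\{(\mathcal R,\mathcal L),(\mathcal L,\mathcal R)\}$, $0\le\theta\le1$ and $0<p\le\infty$ define: - $(A_0,A_1)^{\mathcal X}_{\theta,s,c,r,b,q,a}$: all $f\in A_0+A_1$ with $N^{\mathcal X}_{-\theta}(K(\cdot,f;A_0,A_1))<\infty$; - $L^{\mathcal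 X}_{p,(s,c,r,b,q,a)}$: all $f\in\mathcal M(\Omega,\mu)$ with $N^{\mathcal X}_{1/p}(f^{*})<\infty$; - $(L)^{\mathcal X}_{p,(s,c,r,b,q,a)}$: all $f\in\mathcal M(\Omega,\mu)$ with $N^{\mathcal X}_{1/p}(f^{**})<\infty$; each with the indicated expression as its quasi-norm. Equality of two such spaces means that they have the same elements and that their quasi-norms are equivalent, i.e. each is at most a constant, independent of $f$, times the other. **Theorem.** Let $0<\theta\le1$, $p=\frac1{1-\theta}$, $0<q,r,s\le\infty$ and $a,b,c\in SV$. Then $$(L_1,L_\infty)^{\mathcal R,\mathcal L}_{\theta,s,c,r,b,q,a}=(L_{1,\infty},L_\infty)^{\mathcal R,\mathcal L}_{\theta,s,c,r,b,q,a}=(L)^{\mathcal R,\mathcal L}_{p,(s,c,r,b,q,a)}=L^{\mathcal R,\mathcal L}_{p,(s,c,r,b,q,a)}$$ and $$(L_1,L_\infty)^{\mathcal L,\mathcal R}_{\theta,s,c,r,b,q,a}=(L_{1,\infty},L_\infty)^{\mathcal L,\mathcal R}_{\theta,s,c,r,b,q,a}=(L)^{\mathcal L,\mathcal R}_{p,(s,c,r,b,q,a)}=L^{\mathcal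 L,\mathcal R}_{p,(s,c,r,b,q,a)}.$$ -/

import Mathlib

open MeasureTheory Set
open scoped ENNReal NNReal

namespace LorentzKaramata

/-- Slowly varying functions on `(0,∞)`: `b` is positive and Lebesgue measurable on `(0,∞)` and, for
each `ε > 0`, `t ^ ε * b t` is equivalent to a non-decreasing function and `t ^ (-ε) * b t` is
equivalent to a non-increasing function on `(0,∞)`. -/
structure IsSV (b : ℝ → ℝ) : Prop where
  pos : ∀ t, 0 < t → 0 < b t
  aemeasurable : AEMeasurable b (volume.restrict (Ioi 0))
  equiv_incr : ∀ ε : ℝ, 0 < ε → ∃ g : ℝ → ℝ, MonotoneOn g (Ioi 0) ∧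
    ∃ C : ℝ, 0 < C ∧ ∀ t, 0 < t → C⁻¹ * g t ≤ t ^ ε * b t ∧ t ^ ε * b t ≤ C * g t
  equiv_decr : ∀ ε : ℝ, 0 < ε → ∃ g : ℝ → ℝ, AntitoneOn g (Ioi 0) ∧
    ∃ C : ℝ, 0 < C ∧ ∀ t, 0 < t → C⁻¹ * g t ≤ t ^ (-ε) * b t ∧ t ^ (-ε) * b t ≤ C * g t

/-- Every measurable set of positive measure contains a measurable set of strictly smaller, positive
measure. -/
def Nonatomic {Ω : Type*} [MeasurableSpace Ω] (μ : Measure Ω) : Prop :=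
  ∀ A : Set Ω, MeasurableSet A → 0 < μ A →
    ∃ B : Set Ω, MeasurableSet B ∧ B ⊆ A ∧ 0 < μ B ∧ μ B < μ A

section Spaces

/-- A space of elements of `V`: the set of its elements together with its quasi-norm. -/
structure Space (V : Type*) where
  carrier : Set V
  qnorm : V → ℝ≥0∞

variable {V : Type*}

/-- The space of all elements at which `N` is finite, with the quasi-norm `N`. -/
def Space.ofNorm (N : V → ℝ≥0∞) : Space V where
  carrier := {f | N f < ∞}
  qnorm := N

/-- Continuous embedding `X ⊂ Y`. -/
def Space.Embeds (X Y : Space V) : Prop :=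
  X.carrier ⊆ Y.carrier ∧ ∃ C : ℝ≥0, ∀ f ∈ X.carrier, Y.qnorm f ≤ C * X.qnorm f

/-- Equality of spaces: the same elements and equivalent quasi-norms. -/
def Space.Same (X Y : Space V) : Prop := X.Embeds Y ∧ Y.Embeds X

/-- The elements of `A₀ + A₁`. -/
def sumCarrier [Add V] (A₀ A₁ : Space V) : Set V :=
  {f | ∃ f₀ ∈ A₀.carrier, ∃ f₁ ∈ A₁.carrier, f = f₀ + f₁}

/-- Peetre's `K`-functional `K(t,f;A₀,A₁)`. -/
noncomputable def K [Add V] (A₀ A₁ : Space V) (f : V) (t : ℝ) : ℝ≥0∞ :=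
  ⨅ (f₀ ∈ A₀.carrier) (f₁ ∈ A₁.carrier) (_ : f = f₀ + f₁),
    A₀.qnorm f₀ + ENNReal.ofReal t * A₁.qnorm f₁

end Spaces

section WeightedNorms

/-- `‖ t ^ (α - 1/q) w(t) φ(t) ‖_{q, I}`, the (quasi-)norm in `L_q` on the interval `I ⊆ (0,∞)`. -/
noncomputable def wNorm (α : ℝ) (q : ℝ≥0∞) (w : ℝ → ℝ) (φ : ℝ → ℝ≥0∞) (I : Set ℝ) : ℝ≥0∞ :=
  eLpNorm (fun t => ENNReal.ofReal (t ^ (α - (1 / q).toReal) * w t) * φ t) q (volume.restrict I)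

/-- `‖ t^(-1/s) c(t) ‖ u^(-1/r) b(u) ‖ v^(α-1/q) a(v) φ(v) ‖_{q,(u,t)} ‖_{r,(0,t)} ‖_{s,(0,∞)}` -/
noncomputable def normRL (α : ℝ) (s : ℝ≥0∞) (c : ℝ → ℝ) (r : ℝ≥0∞) (b : ℝ → ℝ)
    (q : ℝ≥0∞) (a : ℝ → ℝ) (φ : ℝ → ℝ≥0∞) : ℝ≥0∞ :=
  wNorm 0 s c (fun t => wNorm 0 r b (fun u => wNorm α q a φ (Ioo u t)) (Ioo 0 t)) (Ioi 0)

/-- `‖ t^(-1/s) c(t) ‖ u^(-1/r) b(u) ‖ v^(α-1/q) a(v) φ(v) ‖_{q,(t,u)} ‖_{r,(t,∞)} ‖_{s,(0,∞)}` -/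
noncomputable def normLR (α : ℝ) (s : ℝ≥0∞) (c : ℝ → ℝ) (r : ℝ≥0∞) (b : ℝ → ℝ)
    (q : ℝ≥0∞) (a : ℝ → ℝ) (φ : ℝ → ℝ≥0∞) : ℝ≥0∞ :=
  wNorm 0 s c (fun t => wNorm 0 r b (fun u => wNorm α q a φ (Ioo t u)) (Ioi t)) (Ioi 0)

end WeightedNorms

section Interpolation

variable {V : Type*} [Add V]

/-- The extremal interpolation space `(A₀,A₁)^{R,L}_{θ,s,c,r,b,q,a}`. -/
noncomputable def interpRL (A₀ A₁ : Space V) (θ : ℝ) (s : ℝ≥0∞) (c : ℝ → ℝ) (r : ℝ≥0∞)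
    (b : ℝ → ℝ) (q : ℝ≥0∞) (a : ℝ → ℝ) : Space V where
  carrier := {f | f ∈ sumCarrier A₀ A₁ ∧ normRL (-θ) s c r b q a (K A₀ A₁ f) < ∞}
  qnorm f := normRL (-θ) s c r b q a (K A₀ A₁ f)

/-- The extremal interpolation space `(A₀,A₁)^{L,R}_{θ,s,c,r,b,q,a}`. -/
noncomputable def interpLR (A₀ A₁ : Space V) (θ : ℝ) (s : ℝ≥0∞) (c : ℝ → ℝ) (r : ℝ≥0∞)
    (b : ℝ → ℝ) (q : ℝ≥0∞) (a : ℝ → ℝ) : Space V where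
  carrier := {f | f ∈ sumCarrier A₀ A₁ ∧ normLR (-θ) s c r b q a (K A₀ A₁ f) < ∞}
  qnorm f := normLR (-θ) s c r b q a (K A₀ A₁ f)

end Interpolation

section FunctionSpaces

variable {Ω : Type*} [MeasurableSpace Ω] {μ : Measure Ω} {𝕜 : Type*} [RCLike 𝕜]

/-- The non-increasing rearrangement `f*(t) = inf {l ≥ 0 : μ {|f| > l} ≤ t}`. -/
noncomputable def rearr (f : Ω →ₘ[μ] 𝕜) (t : ℝ) : ℝ≥0∞ :=
  sInf {l : ℝ≥0∞ | μ {x | l < ‖f x‖ₑ} ≤ ENNReal.ofReal t}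

/-- The maximal function `f**(t) = (1/t) ∫₀ᵗ f*(u) du` of `f*`. -/
noncomputable def maximal (f : Ω →ₘ[μ] 𝕜) (t : ℝ) : ℝ≥0∞ :=
  (ENNReal.ofReal t)⁻¹ * ∫⁻ u in Ioo 0 t, rearr f u

variable (μ 𝕜)

/-- `L_1`. -/
noncomputable def L1 : Space (Ω →ₘ[μ] 𝕜) := Space.ofNorm fun f => eLpNorm f 1 μ

/-- `L_∞`. -/
noncomputable def Linf : Space (Ω →ₘ[μ] 𝕜) := Space.ofNorm fun f => eLpNorm f ∞ μ

/-- `L_{1,∞}`, with the quasi-norm `sup_{t > 0} t f*(t)`. -/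
noncomputable def weakL1 : Space (Ω →ₘ[μ] 𝕜) :=
  Space.ofNorm fun f => ⨆ t ∈ Ioi (0 : ℝ), ENNReal.ofReal t * rearr f t

/-- The Lorentz–Karamata space `L^{R,L}_{p,(s,c,r,b,q,a)}`, defined via `f*`. -/
noncomputable def starRL (p s : ℝ≥0∞) (c : ℝ → ℝ) (r : ℝ≥0∞) (b : ℝ → ℝ) (q : ℝ≥0∞) (a : ℝ → ℝ) :
    Space (Ω →ₘ[μ] 𝕜) :=
  Space.ofNorm fun f => normRL (1 / p).toReal s c r b q a (rearr f)

/-- The Lorentz–Karamata space `(L)^{R,L}_{p,(s,c,r,b,q,a)}`, defined via `f**`. -/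
noncomputable def dstarRL (p s : ℝ≥0∞) (c : ℝ → ℝ) (r : ℝ≥0∞) (b : ℝ → ℝ) (q : ℝ≥0∞) (a : ℝ → ℝ) :
    Space (Ω →ₘ[μ] 𝕜) :=
  Space.ofNorm fun f => normRL (1 / p).toReal s c r b q a (maximal f)

/-- The Lorentz–Karamata space `L^{L,R}_{p,(s,c,r,b,q,a)}`, defined via `f*`. -/
noncomputable def starLR (p s : ℝ≥0∞) (c : ℝ → ℝ) (r : ℝ≥0∞) (b : ℝ → ℝ) (q : ℝ≥0∞) (a : ℝ → ℝ) :
    Space (Ω →ₘ[μ] 𝕜) :=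
  Space.ofNorm fun f => normLR (1 / p).toReal s c r b q a (rearr f)

/-- The Lorentz–Karamata space `(L)^{L,R}_{p,(s,c,r,b,q,a)}`, defined via `f**`. -/
noncomputable def dstarLR (p s : ℝ≥0∞) (c : ℝ → ℝ) (r : ℝ≥0∞) (b : ℝ → ℝ) (q : ℝ≥0∞) (a : ℝ → ℝ) :
    Space (Ω →ₘ[μ] 𝕜) :=
  Space.ofNorm fun f => normLR (1 / p).toReal s c r b q a (maximal f)

end FunctionSpaces

end LorentzKaramata

open LorentzKaramata

/-! Everything rests on the pointwise chain `t f*(t) ≤ K(t,f;L_{1,∞},L_∞) ≤ K(t,f;L_1,L_∞) ≤ 2 t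
f**(t)` (`ofReal_mul_rearr_le_K`, `K_weakL1_le_K_L1`, `K_L1_Linf_le`). Since `t^(-θ) * t = t^(1/p)`,
the four quasi-norms are ordered up to constants, from the one built on `f*` to the one built on
`f**`. The circle is closed by a Hardy inequality, `nestedNorm_average_le`, valid because `1/p = 1 -
θ < 1`.

For the Hardy inequality with exponents possibly below 1, where only a quasi-triangle inequality
holds, `f**(t)` is dominated by `∑ l^n f*(l^(n+1) t)`. Dilation by `l` costs about `l^(-1/p)`, up to
an arbitrarily small power due to the slowly varying weights, while each further term gains a factor
`l`. For `l` small this gain absorbs the quasi-triangle constant at every stage, so the partial sums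
are bounded uniformly and monotone convergence finishes.

Membership in `L_1 + L_∞` is automatic: outside it `f**` is identically `∞`, and so is its
quasi-norm. Only measurability, monotonicity and scaling of the intervals matter, so both kinds of
nested norm are treated together through `IntervalScheme`. -/

namespace LorentzKaramata

/-! ### Weighted quasi-norms on one interval -/

/-- A slowly varying function changes at most by a small power under dilations. -/
lemma IsSV.le_dilate {w : ℝ → ℝ} (hw : IsSV w) {ε : ℝ} (hε : 0 < ε) :
    ∃ M : ℝ, 0 < M ∧ ∀ l, 0 < l → l ≤ 1 → ∀ t, 0 < t → w t ≤ M * l ^ (-ε) * w (l * t) := by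
  obtain ⟨g, hg, C, hC, h⟩ := hw.equiv_decr ε hε
  refine ⟨C * C, by positivity, fun l hl hl1 t ht => ?_⟩
  have hlt : 0 < l * t := by positivity
  have h1 := (h t ht).2
  have h2 := (h _ hlt).1
  have h3 : g t ≤ g (l * t) := hg hlt ht (by nlinarith)
  rw [Real.mul_rpow hl.le ht.le] at h2
  have ht' : 0 < t ^ (-ε) := Real.rpow_pos_of_pos ht _
  have h4 : g (l * t) ≤ C * (l ^ (-ε) * t ^ (-ε) * w (l * t)) := by
    rwa [inv_mul_le_iff₀ hC] at h2
  have h5 : t ^ (-ε) * w t ≤ t ^ (-ε) * (C * C * l ^ (-ε) * w (l * t)) :=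
    calc t ^ (-ε) * w t ≤ C * g t := h1
      _ ≤ C * (C * (l ^ (-ε) * t ^ (-ε) * w (l * t))) := by
        gcongr
        exact h3.trans h4
      _ = _ := by ring
  exact le_of_mul_le_mul_left h5 ht'

lemma IsSV.aemeasurable_weight {w : ℝ → ℝ} (hw : IsSV w) (γ : ℝ) {φ : ℝ → ℝ≥0∞}
    (hφ : Measurable φ) {I : Set ℝ} (hI : I ⊆ Ioi 0) :
    AEMeasurable (fun t => ENNReal.ofReal (t ^ γ * w t) * φ t) (volume.restrict I) := by
  have h1 : AEMeasurable w (volume.restrict I) :=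
    hw.aemeasurable.mono_measure (Measure.restrict_mono hI le_rfl)
  have h2 : Measurable fun t : ℝ => t ^ γ := by fun_prop
  exact ((h2.aemeasurable.mul h1).ennreal_ofReal).mul hφ.aemeasurable

lemma wNorm_mono_set (α : ℝ) (q : ℝ≥0∞) (w : ℝ → ℝ) (φ : ℝ → ℝ≥0∞) {I J : Set ℝ} (h : I ⊆ J) :
    wNorm α q w φ I ≤ wNorm α q w φ J :=
  eLpNorm_mono_measure _ (Measure.restrict_mono h le_rfl)

/-- The factor `t ^ (-1/q) * w t` is common to both sides. Two exponents are allowed so that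
`t^(1-θ) f*` can be compared with `t^(-θ) K`. -/
lemma wNorm_le_mul {α β : ℝ} {q : ℝ≥0∞} {w : ℝ → ℝ} {φ ψ : ℝ → ℝ≥0∞} {I : Set ℝ}
    (hI : I ⊆ Ioi 0) (hm : MeasurableSet I) {C : ℝ≥0}
    (h : ∀ t ∈ I, ENNReal.ofReal (t ^ α) * φ t ≤ C * (ENNReal.ofReal (t ^ β) * ψ t)) :
    wNorm α q w φ I ≤ C * wNorm β q w ψ I := by
  have key : ∀ᵐ t ∂(volume.restrict I),
      ‖ENNReal.ofReal (t ^ (α - (1 / q).toReal) * w t) * φ t‖ₑ ≤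
        C * ‖ENNReal.ofReal (t ^ (β - (1 / q).toReal) * w t) * ψ t‖ₑ := by
    refine ae_restrict_of_forall_mem hm fun t ht => ?_
    have ht0 : 0 < t := hI ht
    simp only [enorm_eq_self]
    have e : ∀ γ : ℝ, ENNReal.ofReal (t ^ (γ - (1 / q).toReal) * w t) =
        ENNReal.ofReal (t ^ (-(1 / q).toReal) * w t) * ENNReal.ofReal (t ^ γ) := by
      intro γ
      rw [sub_eq_add_neg, Real.rpow_add ht0, ← ENNReal.ofReal_mul' (by positivity)]
      congr 1
      ring
    rw [e, e, mul_assoc, mul_assoc, mul_left_comm (C : ℝ≥0∞)]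
    exact mul_le_mul_right (h t ht) _
  have := eLpNorm_le_nnreal_smul_eLpNorm_of_ae_le_mul' key q
  rwa [ENNReal.smul_def, smul_eq_mul] at this

lemma wNorm_const_mul_le {α : ℝ} {q : ℝ≥0∞} {w : ℝ → ℝ} {φ ψ : ℝ → ℝ≥0∞} {I : Set ℝ}
    (hI : I ⊆ Ioi 0) (hm : MeasurableSet I) {C : ℝ≥0} (h : ∀ t ∈ I, φ t ≤ C * ψ t) :
    wNorm α q w φ I ≤ C * wNorm α q w ψ I := by
  refine wNorm_le_mul hI hm fun t ht => ?_
  rw [mul_left_comm (C : ℝ≥0∞)]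
  gcongr
  exact h t ht

lemma wNorm_mono {α : ℝ} {q : ℝ≥0∞} {w : ℝ → ℝ} {φ ψ : ℝ → ℝ≥0∞} {I : Set ℝ}
    (hI : I ⊆ Ioi 0) (hm : MeasurableSet I) (h : ∀ t ∈ I, φ t ≤ ψ t) :
    wNorm α q w φ I ≤ wNorm α q w ψ I := by
  simpa using wNorm_const_mul_le (C := 1) (α := α) (q := q) (w := w) hI hm (by simpa using h)

lemma wNorm_zero (α : ℝ) (q : ℝ≥0∞) (w : ℝ → ℝ) (I : Set ℝ) :
    wNorm α q w (fun _ => 0) I = 0 := by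
  simp [wNorm]

lemma wNorm_top {α : ℝ} {q : ℝ≥0∞} (hq : 0 < q) {w : ℝ → ℝ} (hw : ∀ t, 0 < t → 0 < w t)
    {φ : ℝ → ℝ≥0∞} {I : Set ℝ} (hI : I ⊆ Ioi 0) (hm : MeasurableSet I) (h0 : 0 < volume I)
    (h : ∀ t ∈ I, φ t = ∞) : wNorm α q w φ I = ∞ := by
  have hne : volume.restrict I ≠ 0 := by
    rw [Ne, Measure.restrict_eq_zero]
    exact h0.ne'
  have e : wNorm α q w φ I = eLpNorm (fun _ => (∞ : ℝ≥0∞)) q (volume.restrict I) := by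
    refine eLpNorm_congr_ae (ae_restrict_of_forall_mem hm fun t ht => ?_)
    have ht0 : 0 < t := hI ht
    simp only [h t ht]
    refine ENNReal.mul_top ?_
    have := hw t ht0
    exact (ENNReal.ofReal_pos.2 (by positivity)).ne'
  rw [e, eLpNorm_const _ hq.ne' hne, enorm_eq_self]
  -- The other factor is the total mass to the power `1 / q.toReal`; for `q = ∞` this exponent is
  -- `0` and the factor is `1`.
  refine ENNReal.top_mul fun h => ?_
  rw [ENNReal.rpow_eq_zero_iff] at h
  rcases h with ⟨h, -⟩ | ⟨-, h⟩
  · exact hne (Measure.measure_univ_eq_zero.1 h)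
  · exact absurd h (not_lt.2 (by positivity))

lemma wNorm_add_le {α : ℝ} {q : ℝ≥0∞} {w : ℝ → ℝ} (hw : IsSV w) {φ ψ : ℝ → ℝ≥0∞}
    (hφ : Measurable φ) (hψ : Measurable ψ) {I : Set ℝ} (hI : I ⊆ Ioi 0) :
    wNorm α q w (fun t => φ t + ψ t) I ≤
      ENNReal.LpAddConst q * (wNorm α q w φ I + wNorm α q w ψ I) := by
  have := eLpNorm_add_le' (p := q)
    (hw.aemeasurable_weight (α - (1 / q).toReal) hφ hI).aestronglyMeasurable
    (hw.aemeasurable_weight (α - (1 / q).toReal) hψ hI).aestronglyMeasurable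
  refine le_trans (le_of_eq ?_) this
  unfold wNorm
  congr 1
  ext t
  simp [mul_add]

/-- Monotone convergence for `L_q` quasi-norms. -/
lemma eLpNorm_iSup_le {X : Type*} [MeasurableSpace X] {ν : Measure X} (q : ℝ≥0∞)
    {F : ℕ → X → ℝ≥0∞} (hF : ∀ n, AEMeasurable (F n) ν) (hmono : ∀ x, Monotone fun n => F n x) :
    eLpNorm (fun x => ⨆ n, F n x) q ν ≤ ⨆ n, eLpNorm (F n) q ν := by
  rcases eq_or_ne q 0 with rfl | hq
  · simp
  rcases eq_or_ne q ∞ with rfl | hq'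
  · simp only [eLpNorm_exponent_top, eLpNormEssSup, enorm_eq_self]
    refine essSup_le_of_ae_le _ ?_
    filter_upwards [ae_all_iff.2 fun n => ENNReal.ae_le_essSup (μ := ν) (F n)] with x hx
    exact iSup_mono hx
  · have hpos : 0 < q.toReal := ENNReal.toReal_pos hq hq'
    simp only [eLpNorm_eq_lintegral_rpow_enorm_toReal hq hq', enorm_eq_self]
    have e : ∀ x, (⨆ n, F n x) ^ q.toReal = ⨆ n, F n x ^ q.toReal := fun x =>
      (ENNReal.orderIsoRpow _ hpos).map_iSup _
    simp_rw [e]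
    rw [lintegral_iSup' (fun n => (hF n).pow_const _) (Filter.Eventually.of_forall fun x m n hmn =>
      ENNReal.rpow_le_rpow (hmono x hmn) hpos.le)]
    exact ((ENNReal.orderIsoRpow _ (one_div_pos.2 hpos)).map_iSup _).le

lemma wNorm_iSup_le {α : ℝ} {q : ℝ≥0∞} {w : ℝ → ℝ} (hw : IsSV w) {Φ : ℕ → ℝ → ℝ≥0∞}
    (hΦ : ∀ n, Measurable (Φ n)) (hmono : ∀ t, Monotone fun n => Φ n t) {I : Set ℝ}
    (hI : I ⊆ Ioi 0) :
    wNorm α q w (fun t => ⨆ n, Φ n t) I ≤ ⨆ n, wNorm α q w (Φ n) I := by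
  have := eLpNorm_iSup_le q
    (fun n => hw.aemeasurable_weight (α - (1 / q).toReal) (hΦ n) hI)
    (fun t m n hmn => mul_le_mul_right (hmono t hmn) _)
  simpa only [wNorm, ENNReal.mul_iSup] using this

/-- The change of variables contributes `l ^ (-1/q)`, which cancels against the normalising power `t
^ (-1/q)` of the weight. Only `l ^ (-α)` and the loss `M` from `w` remain. -/
lemma wNorm_dilate_le {α : ℝ} {q : ℝ≥0∞} {w : ℝ → ℝ} {φ : ℝ → ℝ≥0∞} {I : Set ℝ}
    (hI : I ⊆ Ioi 0) (hm : MeasurableSet I) {l M : ℝ} (hl : 0 < l) (hM : 0 ≤ M)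
    (hw : ∀ t, 0 < t → w t ≤ M * w (l * t)) :
    wNorm α q w (fun t => φ (l * t)) ((fun t => l * t) ⁻¹' I) ≤
      (M * l ^ (-α)).toNNReal * wNorm α q w φ I := by
  set σ := (1 / q).toReal with hσ
  have hemb : MeasurableEmbedding fun t : ℝ => l * t := measurableEmbedding_mulLeft₀ hl.ne'
  set F : ℝ → ℝ≥0∞ := fun t => ENNReal.ofReal (t ^ (α - σ) * w t) * φ t
  have key : ∀ᵐ t ∂(volume.restrict ((fun t => l * t) ⁻¹' I)),
      ‖ENNReal.ofReal (t ^ (α - σ) * w t) * φ (l * t)‖ₑ ≤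
        (M * l ^ (σ - α)).toNNReal * ‖(F ∘ fun t => l * t) t‖ₑ := by
    refine ae_restrict_of_forall_mem (hemb.measurable hm) fun t ht => ?_
    have ht0 : 0 < t := (mul_pos_iff_of_pos_left hl).1 (hI ht)
    simp only [enorm_eq_self, Function.comp, F]
    rw [← mul_assoc]
    gcongr
    change _ ≤ ENNReal.ofReal _ * _
    rw [← ENNReal.ofReal_mul (by positivity)]
    refine ENNReal.ofReal_le_ofReal ?_
    have e : l ^ (σ - α) * l ^ (α - σ) = 1 := by
      rw [← Real.rpow_add hl]
      simp
    calc t ^ (α - σ) * w t ≤ t ^ (α - σ) * (M * w (l * t)) := by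
          gcongr
          exact hw t ht0
      _ = (l ^ (σ - α) * l ^ (α - σ)) * (t ^ (α - σ) * (M * w (l * t))) := by rw [e, one_mul]
      _ = _ := by
        rw [Real.mul_rpow hl.le ht0.le]
        ring
  have h1 := eLpNorm_le_nnreal_smul_eLpNorm_of_ae_le_mul' key q
  have h2 : eLpNorm (F ∘ fun t => l * t) q (volume.restrict ((fun t => l * t) ⁻¹' I)) =
      ENNReal.ofReal (l ^ (-σ)) * eLpNorm F q (volume.restrict I) := by
    rw [← hemb.eLpNorm_map_measure, ← hemb.restrict_map, Real.map_volume_mul_left hl.ne',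
      Measure.restrict_smul, eLpNorm_smul_measure_of_ne_zero, smul_eq_mul, ← hσ,
      abs_of_pos (inv_pos.2 hl), ENNReal.ofReal_rpow_of_pos (inv_pos.2 hl), Real.inv_rpow hl.le,
      Real.rpow_neg hl.le]
    exact (ENNReal.ofReal_pos.2 (by positivity)).ne'
  rw [ENNReal.smul_def, smul_eq_mul, h2, ← mul_assoc] at h1
  refine h1.trans (le_of_eq ?_)
  congr 1
  change ENNReal.ofReal _ * _ = ENNReal.ofReal _
  rw [← ENNReal.ofReal_mul (by positivity), mul_assoc, ← Real.rpow_add hl]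
  congr 3
  ring

/-! ### The two nested quasi-norms under one roof -/

/-- Interval families that behave like `J t = (0,t)`, `I t u = (u,t)` or like `J t = (t,∞)`,
`I t u = (t,u)`. -/
structure IntervalScheme (J : ℝ → Set ℝ) (I : ℝ → ℝ → Set ℝ) : Prop where
  measJ : ∀ t, MeasurableSet (J t)
  measI : ∀ t u, MeasurableSet (I t u)
  subJ : ∀ t, 0 < t → J t ⊆ Ioi 0
  subI : ∀ t, 0 < t → ∀ u ∈ J t, I t u ⊆ Ioi 0
  posJ : ∀ t, 0 < t → 0 < volume (J t)
  posI : ∀ t, 0 < t → ∀ u ∈ J t, 0 < volume (I t u)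
  dilJ : ∀ l t, 0 < l → (fun x => l * x) ⁻¹' J (l * t) = J t
  dilI : ∀ l t u, 0 < l → (fun x => l * x) ⁻¹' I (l * t) (l * u) = I t u
  monoI : ∀ t, Monotone (I t) ∨ Antitone (I t)
  mono : (Monotone J ∧ ∀ u, Monotone fun t => I t u) ∨ (Antitone J ∧ ∀ u, Antitone fun t => I t u)

lemma intervalScheme_RL : IntervalScheme (fun t => Ioo 0 t) (fun t u => Ioo u t) where
  measJ _ := measurableSet_Ioo
  measI _ _ := measurableSet_Ioo
  subJ _ _ _ h := h.1
  subI _ _ _ hu _ h := hu.1.trans h.1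
  posJ t ht := by simpa using ht
  posI t _ u hu := by simpa using hu.2
  dilJ l t hl := by
    ext x
    change 0 < l * x ∧ l * x < l * t ↔ 0 < x ∧ x < t
    rw [mul_lt_mul_iff_right₀ hl, mul_pos_iff_of_pos_left hl]
  dilI l t u hl := by
    ext x
    change l * u < l * x ∧ l * x < l * t ↔ u < x ∧ x < t
    rw [mul_lt_mul_iff_right₀ hl, mul_lt_mul_iff_right₀ hl]
  monoI t := Or.inr fun _ _ h => Ioo_subset_Ioo_left h
  mono := Or.inl ⟨fun _ _ h => Ioo_subset_Ioo_right h, fun _ _ _ h => Ioo_subset_Ioo_right h⟩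

lemma intervalScheme_LR : IntervalScheme (fun t => Ioi t) (fun t u => Ioo t u) where
  measJ _ := measurableSet_Ioi
  measI _ _ := measurableSet_Ioo
  subJ _ ht _ h := ht.trans h
  subI _ ht _ _ _ h := ht.trans h.1
  posJ t _ := by simp
  posI t _ u hu := by simpa using hu
  dilJ l t hl := by
    ext x
    change l * t < l * x ↔ t < x
    rw [mul_lt_mul_iff_right₀ hl]
  dilI l t u hl := by
    ext x
    change l * t < l * x ∧ l * x < l * u ↔ t < x ∧ x < u
    rw [mul_lt_mul_iff_right₀ hl, mul_lt_mul_iff_right₀ hl]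
  monoI t := Or.inl fun _ _ h => Ioo_subset_Ioo_right h
  mono := Or.inr ⟨fun _ _ h => Ioi_subset_Ioi h, fun _ _ _ h => Ioo_subset_Ioo_left h⟩

/-- The common form of `normRL` and `normLR`. -/
noncomputable def nestedNorm (J : ℝ → Set ℝ) (I : ℝ → ℝ → Set ℝ) (α : ℝ) (s : ℝ≥0∞) (c : ℝ → ℝ)
    (r : ℝ≥0∞) (b : ℝ → ℝ) (q : ℝ≥0∞) (a : ℝ → ℝ) (φ : ℝ → ℝ≥0∞) : ℝ≥0∞ :=
  wNorm 0 s c (fun t => wNorm 0 r b (fun u => wNorm α q a φ (I t u)) (J t)) (Ioi 0)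

section Nested

variable {J : ℝ → Set ℝ} {I : ℝ → ℝ → Set ℝ} {α : ℝ} {s r q : ℝ≥0∞} {c b a : ℝ → ℝ}

/-- The function is monotone in `u`, hence measurable whatever `φ` is. -/
lemma IntervalScheme.measurable_inner (H : IntervalScheme J I) (φ : ℝ → ℝ≥0∞) (t : ℝ) :
    Measurable fun u => wNorm α q a φ (I t u) := by
  rcases H.monoI t with h | h
  · exact Monotone.measurable fun u v huv => wNorm_mono_set _ _ _ _ (h huv)
  · exact Antitone.measurable fun u v huv => wNorm_mono_set _ _ _ _ (h huv)

/-- Unlike `wNorm_mono`, this imposes nothing on the set, which may leave `(0,∞)` when monotonicity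
on all of `ℝ` is needed. -/
lemma wNorm_mono_everywhere {w : ℝ → ℝ} {φ ψ : ℝ → ℝ≥0∞} (h : ∀ t, φ t ≤ ψ t) (A : Set ℝ) :
    wNorm α q w φ A ≤ wNorm α q w ψ A :=
  eLpNorm_mono_enorm fun t => mul_le_mul_right (h t) _

/-- Both `J t` and `I t u` grow, or both shrink, with `t`; so the norm is monotone in `t`. -/
lemma IntervalScheme.measurable_middle (H : IntervalScheme J I) (φ : ℝ → ℝ≥0∞) :
    Measurable fun t => wNorm 0 r b (fun u => wNorm α q a φ (I t u)) (J t) := by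
  rcases H.mono with ⟨h, h'⟩ | ⟨h, h'⟩
  · exact Monotone.measurable fun t t' htt => (wNorm_mono_set _ _ _ _ (h htt)).trans
      (wNorm_mono_everywhere (fun u => wNorm_mono_set _ _ _ _ (h' u htt)) _)
  · exact Antitone.measurable fun t t' htt => (wNorm_mono_set _ _ _ _ (h htt)).trans
      (wNorm_mono_everywhere (fun u => wNorm_mono_set _ _ _ _ (h' u htt)) _)

lemma nestedNorm_le_mul (H : IntervalScheme J I) {β : ℝ} {φ ψ : ℝ → ℝ≥0∞} {C : ℝ≥0}
    (h : ∀ t, 0 < t → ENNReal.ofReal (t ^ α) * φ t ≤ C * (ENNReal.ofReal (t ^ β) * ψ t)) :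
    nestedNorm J I α s c r b q a φ ≤ C * nestedNorm J I β s c r b q a ψ :=
  wNorm_const_mul_le subset_rfl measurableSet_Ioi fun t ht =>
    wNorm_const_mul_le (H.subJ t ht) (H.measJ t) fun u hu =>
      wNorm_le_mul (H.subI t ht u hu) (H.measI t u) fun v hv => h v (H.subI t ht u hu hv)

lemma nestedNorm_const_mul_le (H : IntervalScheme J I) {φ ψ : ℝ → ℝ≥0∞} {C : ℝ≥0}
    (h : ∀ t, 0 < t → φ t ≤ C * ψ t) :
    nestedNorm J I α s c r b q a φ ≤ C * nestedNorm J I α s c r b q a ψ :=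
  nestedNorm_le_mul H fun t ht => by
    rw [mul_left_comm (C : ℝ≥0∞)]
    exact mul_le_mul_right (h t ht) _

lemma nestedNorm_mono (H : IntervalScheme J I) {φ ψ : ℝ → ℝ≥0∞} (h : ∀ t, 0 < t → φ t ≤ ψ t) :
    nestedNorm J I α s c r b q a φ ≤ nestedNorm J I α s c r b q a ψ := by
  simpa using nestedNorm_const_mul_le (C := 1) (α := α) (s := s) (c := c) (r := r) (b := b)
    (q := q) (a := a) H (by simpa using h)

lemma nestedNorm_zero : nestedNorm J I α s c r b q a (fun _ => 0) = 0 := by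
  simp [nestedNorm, wNorm_zero]

lemma nestedNorm_top (H : IntervalScheme J I) (hq : 0 < q) (hr : 0 < r) (hs : 0 < s)
    (ha : IsSV a) (hb : IsSV b) (hc : IsSV c) {φ : ℝ → ℝ≥0∞} (h : ∀ t, 0 < t → φ t = ∞) :
    nestedNorm J I α s c r b q a φ = ∞ :=
  wNorm_top hs hc.pos subset_rfl measurableSet_Ioi (by simp) fun t ht =>
    wNorm_top hr hb.pos (H.subJ t ht) (H.measJ t) (H.posJ t ht) fun u hu =>
      wNorm_top hq ha.pos (H.subI t ht u hu) (H.measI t u) (H.posI t ht u hu) fun v hv =>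
        h v (H.subI t ht u hu hv)

lemma nestedNorm_add_le (H : IntervalScheme J I) (ha : IsSV a) (hb : IsSV b) (hc : IsSV c) :
    ∃ κ : ℝ≥0, ∀ φ ψ : ℝ → ℝ≥0∞, Measurable φ → Measurable ψ →
      nestedNorm J I α s c r b q a (fun t => φ t + ψ t) ≤
        κ * (nestedNorm J I α s c r b q a φ + nestedNorm J I α s c r b q a ψ) := by
  obtain ⟨κq, hκq⟩ : ∃ k : ℝ≥0, (k : ℝ≥0∞) = ENNReal.LpAddConst q :=
    ⟨_, ENNReal.coe_toNNReal (ENNReal.LpAddConst_lt_top q).ne⟩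
  obtain ⟨κr, hκr⟩ : ∃ k : ℝ≥0, (k : ℝ≥0∞) = ENNReal.LpAddConst r :=
    ⟨_, ENNReal.coe_toNNReal (ENNReal.LpAddConst_lt_top r).ne⟩
  obtain ⟨κs, hκs⟩ : ∃ k : ℝ≥0, (k : ℝ≥0∞) = ENNReal.LpAddConst s :=
    ⟨_, ENNReal.coe_toNNReal (ENNReal.LpAddConst_lt_top s).ne⟩
  refine ⟨κq * κr * κs, fun φ ψ hφ hψ => ?_⟩
  have h2 : ∀ t ∈ Ioi (0 : ℝ),
      wNorm 0 r b (fun u => wNorm α q a (fun t => φ t + ψ t) (I t u)) (J t) ≤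
        ((κq * κr : ℝ≥0) : ℝ≥0∞) * (wNorm 0 r b (fun u => wNorm α q a φ (I t u)) (J t) +
          wNorm 0 r b (fun u => wNorm α q a ψ (I t u)) (J t)) := by
    intro t ht
    have h1 := wNorm_const_mul_le (α := 0) (q := r) (w := b) (H.subJ t ht) (H.measJ t) (C := κq)
      fun u hu => (wNorm_add_le (α := α) (q := q) ha hφ hψ (H.subI t ht u hu)).trans_eq
        (by rw [← hκq])
    refine h1.trans ?_
    rw [ENNReal.coe_mul, mul_assoc, hκr]
    exact mul_le_mul_right (wNorm_add_le hb (H.measurable_inner φ t) (H.measurable_inner ψ t)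
      (H.subJ t ht)) _
  refine (wNorm_const_mul_le subset_rfl measurableSet_Ioi h2).trans ?_
  rw [ENNReal.coe_mul _ κs, mul_assoc, hκs]
  exact mul_le_mul_right (wNorm_add_le hc (H.measurable_middle φ) (H.measurable_middle ψ)
    subset_rfl) _

lemma nestedNorm_iSup_le (H : IntervalScheme J I) (ha : IsSV a) (hb : IsSV b) (hc : IsSV c)
    {Φ : ℕ → ℝ → ℝ≥0∞} (hΦ : ∀ n, Measurable (Φ n)) (hmono : ∀ t, Monotone fun n => Φ n t) :
    nestedNorm J I α s c r b q a (fun t => ⨆ n, Φ n t) ≤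
      ⨆ n, nestedNorm J I α s c r b q a (Φ n) := by
  have m1 : ∀ t u, Monotone fun n => wNorm α q a (Φ n) (I t u) := fun t u m n hmn =>
    wNorm_mono_everywhere (fun t => hmono t hmn) _
  have m2 : ∀ t, Monotone fun n => wNorm 0 r b (fun u => wNorm α q a (Φ n) (I t u)) (J t) :=
    fun t m n hmn => wNorm_mono_everywhere (fun u => m1 t u hmn) _
  refine le_trans (wNorm_mono subset_rfl measurableSet_Ioi fun t ht => ?_)
    (wNorm_iSup_le hc (fun n => H.measurable_middle (Φ n)) m2 subset_rfl)
  refine le_trans (wNorm_mono (H.subJ t ht) (H.measJ t) fun u hu => ?_)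
    (wNorm_iSup_le hb (fun n => H.measurable_inner (Φ n) t) (m1 t) (H.subJ t ht))
  exact wNorm_iSup_le ha hΦ hmono (H.subI t ht u hu)

lemma nestedNorm_dilate_le (H : IntervalScheme J I) (ha : IsSV a) (hb : IsSV b) (hc : IsSV c)
    {ε : ℝ} (hε : 0 < ε) :
    ∃ M : ℝ, 0 < M ∧ ∀ l, 0 < l → l ≤ 1 → ∀ φ : ℝ → ℝ≥0∞,
      nestedNorm J I α s c r b q a (fun t => φ (l * t)) ≤
        (M * l ^ (-(α + 3 * ε))).toNNReal * nestedNorm J I α s c r b q a φ := by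
  obtain ⟨Ma, hMa, ha'⟩ := ha.le_dilate hε
  obtain ⟨Mb, hMb, hb'⟩ := hb.le_dilate hε
  obtain ⟨Mc, hMc, hc'⟩ := hc.le_dilate hε
  refine ⟨Ma * Mb * Mc, by positivity, fun l hl hl1 φ => ?_⟩
  -- Each of the three weights loses one factor `p`, whence `3 * ε`; the power `l ^ (-α)` comes from
  -- the innermost norm alone.
  set p : ℝ := l ^ (-ε)
  have hp : 0 < p := Real.rpow_pos_of_pos hl _
  set G : ℝ → ℝ → ℝ≥0∞ := fun t u => wNorm α q a φ (I t u)
  set K : ℝ → ℝ≥0∞ := fun t => wNorm 0 r b (G t) (J t)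
  have h1 : ∀ t, 0 < t → ∀ u ∈ J t, wNorm α q a (fun t => φ (l * t)) (I t u) ≤
      (Ma * p * l ^ (-α)).toNNReal * G (l * t) (l * u) := by
    intro t ht u hu
    have hu' : l * u ∈ J (l * t) := by
      rw [← H.dilJ l t hl] at hu
      exact hu
    rw [← H.dilI l t u hl]
    exact wNorm_dilate_le (H.subI _ (mul_pos hl ht) _ hu') (H.measI _ _) hl (by positivity)
      (ha' l hl hl1)
  have h2 : ∀ t, 0 < t → wNorm 0 r b (fun u => wNorm α q a (fun t => φ (l * t)) (I t u)) (J t) ≤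
      ((Ma * p * l ^ (-α)).toNNReal * (Mb * p).toNNReal : ℝ≥0) * K (l * t) := by
    intro t ht
    refine (wNorm_const_mul_le (H.subJ t ht) (H.measJ t) (h1 t ht)).trans ?_
    rw [ENNReal.coe_mul, mul_assoc ((Ma * p * l ^ (-α)).toNNReal : ℝ≥0∞)]
    refine mul_le_mul_right ?_ _
    have := wNorm_dilate_le (α := 0) (q := r) (φ := G (l * t)) (H.subJ _ (mul_pos hl ht))
      (H.measJ _) hl (by positivity) (hb' l hl hl1)
    simpa [H.dilJ l t hl] using this
  have h3 : (fun x => l * x) ⁻¹' Ioi (0 : ℝ) = Ioi 0 := by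
    ext x
    simp [hl]
  have h4 := wNorm_dilate_le (α := 0) (q := s) (φ := K) subset_rfl
      measurableSet_Ioi hl (by positivity) (hc' l hl hl1)
  rw [h3] at h4
  refine (wNorm_const_mul_le subset_rfl measurableSet_Ioi h2).trans
    ((mul_le_mul_right h4 _).trans (le_of_eq ?_))
  rw [← mul_assoc, ← ENNReal.coe_mul]
  change _ * nestedNorm J I α s c r b q a φ = _
  congr 2
  rw [← Real.toNNReal_mul (by positivity), ← Real.toNNReal_mul (by positivity)]
  congr 1
  have e : l ^ (-(α + 3 * ε)) = l ^ (-α) * (p * p * p) := by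
    simp only [p]
    rw [← Real.rpow_add hl, ← Real.rpow_add hl, ← Real.rpow_add hl]
    congr 1
    ring
  rw [e]
  simp only [neg_zero, Real.rpow_zero]
  ring

/-! ### Hardy's inequality by iterated dilation -/

/-- The averages `(1/t) ∫_(l ^ n t, t) φ` are dominated by these sums of dilations of `φ`. -/
noncomputable def dilationSum (l : ℝ) (φ : ℝ → ℝ≥0∞) : ℕ → ℝ → ℝ≥0∞
  | 0 => fun _ => 0
  | n + 1 => fun t => φ (l * t) + l.toNNReal * dilationSum l φ n (l * t)

lemma dilationSum_antitone {l : ℝ} (hl : 0 < l) {φ : ℝ → ℝ≥0∞} (hφ : Antitone φ) (n : ℕ) :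
    Antitone (dilationSum l φ n) := by
  induction n with
  | zero => exact antitone_const
  | succ n ih =>
    intro t t' h
    have : l * t ≤ l * t' := by gcongr
    exact add_le_add (hφ this) (mul_le_mul_right (ih this) _)

lemma dilationSum_mono (l : ℝ) (φ : ℝ → ℝ≥0∞) (t : ℝ) :
    Monotone fun n => dilationSum l φ n t := by
  refine monotone_nat_of_le_succ fun n => ?_
  induction n generalizing t with
  | zero => exact bot_le
  | succ n ih => exact add_le_add le_rfl (mul_le_mul_right (ih _) _)

/-- Split at `l * t`: on `[l t, t)` the integrand is at most `φ (l * t)` and the length at most `t`.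
What is left is the same integral with `l * t` in place of `t` and one step fewer. -/
lemma setLIntegral_le_dilationSum {l : ℝ} (hl : 0 < l) {φ : ℝ → ℝ≥0∞}
    (hφ : Antitone φ) (n : ℕ) {t : ℝ} (ht : 0 < t) :
    ∫⁻ u in Ioo (l ^ n * t) t, φ u ≤ ENNReal.ofReal t * dilationSum l φ n t := by
  induction n generalizing t with
  | zero => simp
  | succ n ih =>
    have hlt : 0 < l * t := mul_pos hl ht
    have hsub : Ioo (l ^ (n + 1) * t) t ⊆ Ioo (l ^ n * (l * t)) (l * t) ∪ Ico (l * t) t := by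
      intro x hx
      rcases lt_or_ge x (l * t) with h | h
      · exact Or.inl ⟨by rw [← mul_assoc, ← pow_succ]; exact hx.1, h⟩
      · exact Or.inr ⟨h, hx.2⟩
    have h1 : ∫⁻ u in Ico (l * t) t, φ u ≤ ENNReal.ofReal t * φ (l * t) :=
      calc ∫⁻ u in Ico (l * t) t, φ u ≤ ∫⁻ _ in Ico (l * t) t, φ (l * t) :=
            setLIntegral_mono' measurableSet_Ico fun x hx => hφ hx.1
        _ = ENNReal.ofReal (t - l * t) * φ (l * t) := by
            rw [setLIntegral_const, Real.volume_Ico, mul_comm]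
        _ ≤ _ := by
            gcongr
            linarith
    calc ∫⁻ u in Ioo (l ^ (n + 1) * t) t, φ u
        ≤ ∫⁻ u in Ioo (l ^ n * (l * t)) (l * t) ∪ Ico (l * t) t, φ u := lintegral_mono_set hsub
      _ ≤ _ := lintegral_union_le _ _ _
      _ ≤ ENNReal.ofReal (l * t) * dilationSum l φ n (l * t) + ENNReal.ofReal t * φ (l * t) :=
          add_le_add (ih hlt) h1
      _ = _ := by
          simp only [dilationSum]
          rw [ENNReal.ofReal_mul hl.le, mul_add, add_comm]
          congr 1
          rw [mul_comm (ENNReal.ofReal l), mul_assoc]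
          rfl

lemma average_le_iSup_dilationSum {l : ℝ} (hl : 0 < l) (hl1 : l < 1) {φ : ℝ → ℝ≥0∞}
    (hφ : Antitone φ) {t : ℝ} (ht : 0 < t) :
    (ENNReal.ofReal t)⁻¹ * ∫⁻ u in Ioo 0 t, φ u ≤ ⨆ n, dilationSum l φ n t := by
  have hU : Ioo 0 t = ⋃ n : ℕ, Ioo (l ^ n * t) t := by
    ext x
    simp only [mem_Ioo, mem_iUnion]
    constructor
    · rintro ⟨h0, h1⟩
      obtain ⟨n, hn⟩ := exists_pow_lt_of_lt_one (div_pos h0 ht) hl1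
      exact ⟨n, (lt_div_iff₀ ht).1 hn, h1⟩
    · rintro ⟨n, h0, h1⟩
      exact ⟨lt_trans (by positivity) h0, h1⟩
  have hdir : Directed (· ⊆ ·) fun n : ℕ => Ioo (l ^ n * t) t := by
    refine Monotone.directed_le (f := fun n : ℕ => Ioo (l ^ n * t) t) fun m n hmn => ?_
    refine Ioo_subset_Ioo_left ?_
    exact mul_le_mul_of_nonneg_right (pow_le_pow_of_le_one hl.le hl1.le hmn) ht.le
  rw [hU, setLIntegral_iUnion_of_directed _ hdir, ENNReal.mul_iSup]
  refine iSup_mono fun n => ?_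
  rw [ENNReal.inv_mul_le_iff (ENNReal.ofReal_pos.2 ht).ne' ENNReal.ofReal_ne_top]
  exact setLIntegral_le_dilationSum hl hφ n ht

/-- Hardy's inequality for non-increasing functions in the nested quasi-norms. -/
lemma nestedNorm_average_le (H : IntervalScheme J I) (hα : α < 1) (ha : IsSV a) (hb : IsSV b)
    (hc : IsSV c) : ∃ C : ℝ≥0, ∀ φ : ℝ → ℝ≥0∞, Antitone φ →
      nestedNorm J I α s c r b q a (fun t => (ENNReal.ofReal t)⁻¹ * ∫⁻ u in Ioo 0 t, φ u) ≤
        C * nestedNorm J I α s c r b q a φ := by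
  -- Half of the gap `1 - α` is spent on the weights; the other half makes `D * l = M * l ^ δ`
  -- small.
  set δ : ℝ := (1 - α) / 2 with hδ
  have hδ0 : 0 < δ := by linarith
  obtain ⟨κ, hκ⟩ := nestedNorm_add_le (α := α) (s := s) (r := r) (q := q) H ha hb hc
  obtain ⟨M, hM, hD⟩ := nestedNorm_dilate_le (α := α) (s := s) (r := r) (q := q) H ha hb hc
    (ε := δ / 3) (by positivity)
  set B : ℝ := 2 * κ * M + 1
  have hB : 1 ≤ B := by
    have : 0 ≤ 2 * (κ : ℝ) * M := by positivity
    linarith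
  obtain ⟨l, hl, hl1, hlB⟩ : ∃ l : ℝ, 0 < l ∧ l < 1 ∧ l ^ δ * (2 * κ * M) ≤ 1 := by
    -- Solves `l ^ δ = 1 / (2 * B)`; the `+ 1` in `B` forces `l < 1` even if `κ = 0`.
    refine ⟨(2 * B)⁻¹ ^ δ⁻¹, by positivity, ?_, ?_⟩
    · refine Real.rpow_lt_one (by positivity) ?_ (by positivity)
      exact inv_lt_one_of_one_lt₀ (by linarith)
    · rw [Real.rpow_inv_rpow (by positivity) hδ0.ne', inv_mul_le_iff₀ (by positivity)]
      linarith
  set D : ℝ≥0 := (M * l ^ (-(α + 3 * (δ / 3)))).toNNReal with hDdef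
  have hsmall : κ * D * l.toNNReal ≤ 1 / 2 := by
    rw [← NNReal.coe_le_coe]
    push_cast
    rw [hDdef, Real.coe_toNNReal _ (by positivity), Real.coe_toNNReal _ hl.le]
    have e : l ^ δ = l ^ (-(α + 3 * (δ / 3))) * l := by
      conv_rhs => rw [← Real.rpow_one l, ← Real.rpow_mul hl.le, ← Real.rpow_add hl]
      congr 1
      rw [hδ]
      ring
    rw [e] at hlB
    linarith
  refine ⟨2 * (κ * D), fun φ hφ => ?_⟩
  set N := nestedNorm J I α s c r b q a with hN
  -- The bound is the fixed point of `x = κ * D * N φ + x / 2`. Nothing is subtracted, so `N φ = ∞`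
  -- is harmless.
  have hS : ∀ n, N (dilationSum l φ n) ≤ (2 * (κ * D) : ℝ≥0) * N φ := by
    intro n
    induction n with
    | zero => exact (nestedNorm_zero).trans_le (bot_le)
    | succ n ih =>
      have hm : Measurable fun t : ℝ => l * t := measurable_const_mul l
      have hm1 := hφ.measurable.comp hm
      have hm2 := (dilationSum_antitone hl hφ n).measurable.comp hm
      have h1 : N (dilationSum l φ (n + 1)) ≤ _ := hκ _ _ hm1 (hm2.const_mul (l.toNNReal : ℝ≥0∞))
      have h2 : N (fun t => l.toNNReal * dilationSum l φ n (l * t)) ≤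
          l.toNNReal * (D * N (dilationSum l φ n)) :=
        (nestedNorm_const_mul_le H fun t _ => le_rfl).trans
          (mul_le_mul_right (hD l hl hl1.le _) _)
      calc N (dilationSum l φ (n + 1))
          ≤ κ * (D * N φ + l.toNNReal * (D * N (dilationSum l φ n))) :=
            h1.trans (mul_le_mul_right (add_le_add (hD l hl hl1.le φ) h2) _)
        _ = (κ * D : ℝ≥0) * N φ + (κ * D * l.toNNReal : ℝ≥0) * N (dilationSum l φ n) := by
            push_cast
            ring
        _ ≤ (κ * D : ℝ≥0) * N φ + (1 / 2 : ℝ≥0) * ((2 * (κ * D) : ℝ≥0) * N φ) := by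
            gcongr
        _ = (2 * (κ * D) : ℝ≥0) * N φ := by
            rw [← mul_assoc, ← ENNReal.coe_mul, ← add_mul, ← ENNReal.coe_add]
            congr 2
            rw [← mul_assoc]
            norm_num
            ring
  refine (nestedNorm_mono H fun t ht => average_le_iSup_dilationSum hl hl1 hφ ht).trans ?_
  exact (nestedNorm_iSup_le H ha hb hc (fun n => (dilationSum_antitone hl hφ n).measurable)
    (dilationSum_mono l φ)).trans (iSup_le hS)

end Nested

/-! ### Rearrangements and the `K`-functional -/

section Rearrangement

variable {Ω : Type*} [MeasurableSpace Ω] {μ : Measure Ω} {𝕜 : Type*} [RCLike 𝕜]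

lemma rearr_antitone (f : Ω →ₘ[μ] 𝕜) : Antitone (rearr f) := fun _ _ h =>
  sInf_le_sInf fun _ hl => le_trans hl (ENNReal.ofReal_le_ofReal h)

/-- The infimum defining `f*(t)` is attained: along levels decreasing to it the superlevel sets
increase to this one, and measure is continuous from below. -/
lemma measure_rearr_lt_le (f : Ω →ₘ[μ] 𝕜) (t : ℝ) :
    μ {x | rearr f t < ‖f x‖ₑ} ≤ ENNReal.ofReal t := by
  obtain ⟨u, hu, hlim, hmem⟩ := exists_seq_tendsto_sInf
    (S := {l : ℝ≥0∞ | μ {x | l < ‖f x‖ₑ} ≤ ENNReal.ofReal t}) ⟨∞, by simp⟩ (OrderBot.bddBelow _)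
  have hU : {x | rearr f t < ‖f x‖ₑ} = ⋃ n, {x | u n < ‖f x‖ₑ} := by
    ext x
    simp only [mem_ofPred_eq, mem_iUnion]
    exact ⟨fun h => (hlim.eventually (gt_mem_nhds h)).exists,
      fun ⟨n, hn⟩ => (sInf_le (hmem n)).trans_lt hn⟩
  have hmono : Monotone fun n => {x | u n < ‖f x‖ₑ} := fun m n hmn x hx => (hu hmn).trans_lt hx
  rw [hU, hmono.measure_iUnion]
  exact iSup_le hmem

lemma rearr_le_iff (f : Ω →ₘ[μ] 𝕜) (t : ℝ) (l : ℝ≥0∞) :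
    rearr f t ≤ l ↔ μ {x | l < ‖f x‖ₑ} ≤ ENNReal.ofReal t :=
  ⟨fun h => (measure_mono fun _ hx => h.trans_lt hx).trans (measure_rearr_lt_le f t),
    fun h => sInf_le h⟩

lemma lt_rearr_iff (f : Ω →ₘ[μ] 𝕜) (t : ℝ) (l : ℝ≥0∞) :
    l < rearr f t ↔ ENNReal.ofReal t < μ {x | l < ‖f x‖ₑ} := by
  rw [← not_le, rearr_le_iff, not_le]

lemma measurable_enorm_coe (f : Ω →ₘ[μ] 𝕜) : Measurable fun x => ‖f x‖ₑ :=
  f.stronglyMeasurable.enorm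

/-- Chebyshev's inequality at each level `l < f*(t)`, where `μ {|f| > l} > t`. -/
lemma ofReal_mul_rearr_le_eLpNorm_one (f : Ω →ₘ[μ] 𝕜) (t : ℝ) :
    ENNReal.ofReal t * rearr f t ≤ eLpNorm f 1 μ := by
  refine ENNReal.mul_le_of_forall_lt fun a ha l hl => ?_
  rw [lt_rearr_iff] at hl
  rw [eLpNorm_one_eq_lintegral_enorm, mul_comm]
  calc l * a ≤ l * μ {x | l ≤ ‖f x‖ₑ} := by
        gcongr
        exact (ha.trans hl).le.trans (measure_mono fun x (h : l < ‖f x‖ₑ) => show l ≤ ‖f x‖ₑ from h.le)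
    _ ≤ _ := mul_meas_ge_le_lintegral (measurable_enorm_coe f) l

lemma rearr_add_le (f g : Ω →ₘ[μ] 𝕜) (t : ℝ) :
    rearr (f + g) t ≤ rearr f t + eLpNorm g ∞ μ := by
  rw [rearr_le_iff]
  refine le_trans (measure_mono_ae ?_) (measure_rearr_lt_le f t)
  have hg : ∀ᵐ x ∂μ, ‖g x‖ₑ ≤ eLpNorm g ∞ μ := by
    simpa only [eLpNorm_exponent_top] using enorm_ae_le_eLpNormEssSup g μ
  filter_upwards [AEEqFun.coeFn_add f g, hg] with x hx hgx h
  change _ < _ at h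
  change _ < _
  by_contra! hc
  refine absurd h (not_lt.2 ?_)
  rw [hx]
  exact (enorm_add_le _ _).trans (add_le_add hc hgx)

lemma ofReal_mul_rearr_le_lintegral (f : Ω →ₘ[μ] 𝕜) (t : ℝ) :
    ENNReal.ofReal t * rearr f t ≤ ∫⁻ u in Ioo 0 t, rearr f u :=
  calc ENNReal.ofReal t * rearr f t = ∫⁻ _ in Ioo 0 t, rearr f t := by
        rw [setLIntegral_const, Real.volume_Ioo, sub_zero, mul_comm]
    _ ≤ _ := setLIntegral_mono' measurableSet_Ioo fun u hu => rearr_antitone f hu.2.le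

lemma rearr_le_maximal (f : Ω →ₘ[μ] 𝕜) {t : ℝ} (ht : 0 < t) : rearr f t ≤ maximal f t := by
  rw [maximal, mul_comm, ← div_eq_mul_inv, ENNReal.le_div_iff_mul_le
    (Or.inl (ENNReal.ofReal_pos.2 ht).ne') (Or.inl ENNReal.ofReal_ne_top), mul_comm]
  exact ofReal_mul_rearr_le_lintegral f t

lemma ofReal_mul_maximal (f : Ω →ₘ[μ] 𝕜) {t : ℝ} (ht : 0 < t) :
    ENNReal.ofReal t * maximal f t = ∫⁻ u in Ioo 0 t, rearr f u := by
  rw [maximal, ENNReal.mul_inv_cancel_left (ENNReal.ofReal_pos.2 ht).ne' ENNReal.ofReal_ne_top]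

/-- The integral of `|f|` over `{|f| > f*(t)}` is at most `∫₀ᵗ f*`. -/
lemma setLIntegral_enorm_le_lintegral_rearr (f : Ω →ₘ[μ] 𝕜) {t : ℝ} (ht : 0 < t) :
    ∫⁻ x in {x | rearr f t < ‖f x‖ₑ}, ‖f x‖ₑ ∂μ ≤ ∫⁻ u in Ioo 0 t, rearr f u := by
  -- If `f*` is infinite at some positive point, it is infinite to the left of it and the right side
  -- is `∞`. Otherwise real values allow the layer-cake formula on both sides, compared level by
  -- level.
  by_cases hfin : ∀ u, 0 < u → rearr f u ≠ ∞
  · set S := {x | rearr f t < ‖f x‖ₑ} with hS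
    have e1 : ∫⁻ x in S, ‖f x‖ₑ ∂μ = ∫⁻ l in Ioi (0 : ℝ), μ.restrict S {x | l < ‖f x‖} := by
      rw [← lintegral_eq_lintegral_meas_lt (μ.restrict S)
        (Filter.Eventually.of_forall fun x => norm_nonneg _)
        (f.stronglyMeasurable.norm.measurable.aemeasurable)]
      simp only [ofReal_norm]
    have hmt : Measurable fun u => (rearr f u).toReal := (rearr_antitone f).measurable.ennreal_toReal
    have e2 : ∫⁻ u in Ioo 0 t, rearr f u =
        ∫⁻ l in Ioi (0 : ℝ), volume.restrict (Ioo 0 t) {u | l < (rearr f u).toReal} := by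
      rw [← lintegral_eq_lintegral_meas_lt (volume.restrict (Ioo 0 t))
        (Filter.Eventually.of_forall fun u => ENNReal.toReal_nonneg) hmt.aemeasurable]
      exact setLIntegral_congr_fun measurableSet_Ioo fun u hu =>
        (ENNReal.ofReal_toReal (hfin u hu.1)).symm
    rw [e1, e2]
    refine setLIntegral_mono' measurableSet_Ioi fun l hl => ?_
    have hl0 : (0 : ℝ) ≤ l := le_of_lt hl
    have hlt : ∀ x, l < ‖f x‖ ↔ ENNReal.ofReal l < ‖f x‖ₑ := fun x => by
      rw [← ofReal_norm, ENNReal.ofReal_lt_ofReal_iff_of_nonneg hl0]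
    have hmS : MeasurableSet {x | l < ‖f x‖} :=
      measurableSet_lt measurable_const f.stronglyMeasurable.norm.measurable
    rw [Measure.restrict_apply hmS, Measure.restrict_apply (measurableSet_lt measurable_const hmt)]
    set d := μ ({x | l < ‖f x‖} ∩ S)
    have hd : d ≤ ENNReal.ofReal t := (measure_mono inter_subset_right).trans
      (measure_rearr_lt_le f t)
    have hdtop : d ≠ ∞ := ne_top_of_le_ne_top ENNReal.ofReal_ne_top hd
    -- Every `u` in `(0, d)` satisfies `u < d ≤ μ {|f| > l}`, hence `f*(u) > l`; and `d ≤ t`.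
    calc d = volume (Ioo 0 d.toReal) := by
          rw [Real.volume_Ioo, sub_zero, ENNReal.ofReal_toReal hdtop]
      _ ≤ _ := by
        refine measure_mono fun u hu => ⟨?_, hu.1, hu.2.trans_le ?_⟩
        · change l < (rearr f u).toReal
          rw [← ENNReal.ofReal_lt_iff_lt_toReal hl0 (hfin u hu.1), lt_rearr_iff]
          refine ((ENNReal.ofReal_lt_iff_lt_toReal hu.1.le hdtop).2 hu.2).trans_le
            (measure_mono fun x hx => (hlt x).1 hx.1)
        · exact ENNReal.toReal_le_of_le_ofReal ht.le hd
  · push Not at hfin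
    obtain ⟨u, hu, htop⟩ := hfin
    have h : (∞ : ℝ≥0∞) ≤ ∫⁻ v in Ioo 0 t, rearr f v :=
      calc (∞ : ℝ≥0∞) = ∫⁻ _ in Ioo 0 (min u t), (∞ : ℝ≥0∞) := by
            rw [setLIntegral_const, Real.volume_Ioo, sub_zero, ENNReal.top_mul]
            exact (ENNReal.ofReal_pos.2 (lt_min hu ht)).ne'
        _ ≤ ∫⁻ v in Ioo 0 (min u t), rearr f v :=
            setLIntegral_mono' measurableSet_Ioo fun v hv => htop ▸ rearr_antitone f
              (hv.2.le.trans (min_le_left _ _))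
        _ ≤ _ := lintegral_mono_set (Ioo_subset_Ioo_right (min_le_right _ _))
    exact le_top.trans h

lemma eLpNorm_mk_le {g : Ω → 𝕜} (hg : AEStronglyMeasurable g μ) (p : ℝ≥0∞) :
    eLpNorm (AEEqFun.mk g hg) p μ = eLpNorm g p μ :=
  eLpNorm_congr_ae (AEEqFun.coeFn_mk g hg)

/-- Split `f` by restricting it to `{|f| > f*(t)}` and to the complement. The first piece has `L_1`
norm at most `∫₀ᵗ f*`, the second is bounded by `f*(t)`, and `t f*(t)` is again at most that
integral, which gives the factor 2. -/
lemma K_L1_Linf_le (f : Ω →ₘ[μ] 𝕜) {t : ℝ} (ht : 0 < t) :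
    K (L1 μ 𝕜) (Linf μ 𝕜) f t ≤ 2 * ∫⁻ u in Ioo 0 t, rearr f u := by
  rcases eq_or_ne (∫⁻ u in Ioo 0 t, rearr f u) ∞ with htop | hfin
  · simp [htop]
  have hft : rearr f t ≠ ∞ := by
    intro h
    refine hfin (top_le_iff.1 (le_trans (le_of_eq ?_) (ofReal_mul_rearr_le_lintegral f t)))
    rw [h, ENNReal.mul_top (ENNReal.ofReal_pos.2 ht).ne']
  set S := {x | rearr f t < ‖f x‖ₑ} with hS
  have hSm : MeasurableSet S := measurableSet_lt measurable_const (measurable_enorm_coe f)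
  have m0 : AEStronglyMeasurable (S.indicator f) μ :=
    (f.stronglyMeasurable.indicator hSm).aestronglyMeasurable
  have m1 : AEStronglyMeasurable (Sᶜ.indicator f) μ :=
    (f.stronglyMeasurable.indicator hSm.compl).aestronglyMeasurable
  have hsum : f = AEEqFun.mk _ m0 + AEEqFun.mk _ m1 := by
    rw [AEEqFun.mk_add_mk]
    conv_lhs => rw [← AEEqFun.mk_coeFn f]
    simp only [indicator_self_add_compl]
  have n0 : eLpNorm (AEEqFun.mk _ m0) 1 μ ≤ ∫⁻ u in Ioo 0 t, rearr f u := by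
    rw [eLpNorm_mk_le, eLpNorm_indicator_eq_eLpNorm_restrict hSm, eLpNorm_one_eq_lintegral_enorm]
    exact setLIntegral_enorm_le_lintegral_rearr f ht
  have n1 : eLpNorm (AEEqFun.mk _ m1) ∞ μ ≤ rearr f t := by
    rw [eLpNorm_mk_le, eLpNorm_exponent_top]
    refine essSup_le_of_ae_le _ (Filter.Eventually.of_forall fun x => ?_)
    by_cases hx : x ∈ S
    · simp [hx]
    · beta_reduce
      rw [indicator_of_mem (show x ∈ Sᶜ from hx)]
      exact not_lt.1 hx
  have c0 : AEEqFun.mk _ m0 ∈ (L1 μ 𝕜).carrier := n0.trans_lt hfin.lt_top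
  have c1 : AEEqFun.mk _ m1 ∈ (Linf μ 𝕜).carrier := n1.trans_lt hft.lt_top
  refine (iInf₂_le_of_le _ c0 (iInf₂_le_of_le _ c1 (iInf_le _ hsum))).trans ?_
  rw [two_mul]
  exact add_le_add n0 ((mul_le_mul_right n1 _).trans (ofReal_mul_rearr_le_lintegral f t))

lemma L1_subset_weakL1 : (L1 μ 𝕜).carrier ⊆ (weakL1 μ 𝕜).carrier := fun f hf =>
  lt_of_le_of_lt (iSup₂_le fun t _ => ofReal_mul_rearr_le_eLpNorm_one f t) hf

lemma sumCarrier_L1_subset :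
    sumCarrier (L1 μ 𝕜) (Linf μ 𝕜) ⊆ sumCarrier (weakL1 μ 𝕜) (Linf μ 𝕜) :=
  fun _ ⟨f₀, h₀, f₁, h₁, h⟩ => ⟨f₀, L1_subset_weakL1 h₀, f₁, h₁, h⟩

lemma K_weakL1_le_K_L1 (f : Ω →ₘ[μ] 𝕜) (t : ℝ) :
    K (weakL1 μ 𝕜) (Linf μ 𝕜) f t ≤ K (L1 μ 𝕜) (Linf μ 𝕜) f t := by
  refine le_iInf₂ fun f₀ h₀ => le_iInf₂ fun f₁ h₁ => le_iInf fun h => ?_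
  refine (iInf₂_le_of_le f₀ (L1_subset_weakL1 h₀) (iInf₂_le_of_le f₁ h₁ (iInf_le _ h))).trans ?_
  exact add_le_add (iSup₂_le fun t _ => ofReal_mul_rearr_le_eLpNorm_one f₀ t) le_rfl

lemma ofReal_mul_rearr_le_K (f : Ω →ₘ[μ] 𝕜) {t : ℝ} (ht : 0 < t) :
    ENNReal.ofReal t * rearr f t ≤ K (weakL1 μ 𝕜) (Linf μ 𝕜) f t := by
  refine le_iInf₂ fun f₀ h₀ => le_iInf₂ fun f₁ h₁ => le_iInf fun h => ?_
  rw [h]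
  refine (mul_le_mul_right (rearr_add_le f₀ f₁ t) _).trans ?_
  rw [mul_add]
  exact add_le_add (le_iSup₂ (f := fun t (_ : t ∈ Ioi (0 : ℝ)) => ENNReal.ofReal t * rearr f₀ t)
    t ht) le_rfl

end Rearrangement

/-- An infimum over no decompositions is `∞`. -/
lemma mem_sumCarrier_of_K_lt_top {V : Type*} [Add V] {A₀ A₁ : Space V} {f : V} {t : ℝ}
    (h : K A₀ A₁ f t < ∞) : f ∈ sumCarrier A₀ A₁ := by
  simp only [K, iInf_lt_iff] at h
  obtain ⟨f₀, h₀, f₁, h₁, hf, -⟩ := h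
  exact ⟨f₀, h₀, f₁, h₁, hf⟩

lemma maximal_eq_top {Ω : Type*} [MeasurableSpace Ω] {μ : Measure Ω} {𝕜 : Type*}
    [RCLike 𝕜] (f : Ω →ₘ[μ] 𝕜) (h : f ∉ sumCarrier (L1 μ 𝕜) (Linf μ 𝕜)) {t : ℝ} (ht : 0 < t) :
    maximal f t = ∞ := by
  by_contra hne
  refine h (mem_sumCarrier_of_K_lt_top (t := t) ((K_L1_Linf_le f ht).trans_lt ?_))
  rw [← ofReal_mul_maximal f ht]
  exact ENNReal.mul_lt_top ENNReal.ofNat_lt_top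
    (ENNReal.mul_lt_top ENNReal.ofReal_lt_top (lt_top_iff_ne_top.2 hne))

/-! ### Closing the circle of embeddings -/

section Comparison

variable {J : ℝ → Set ℝ} {I : ℝ → ℝ → Set ℝ} {θ : ℝ} {s r q : ℝ≥0∞} {c b a : ℝ → ℝ}
  {Ω : Type*} [MeasurableSpace Ω] {μ : Measure Ω} {𝕜 : Type*} [RCLike 𝕜]

lemma ofReal_rpow_one_sub (θ : ℝ) {t : ℝ} (ht : 0 < t) :
    ENNReal.ofReal (t ^ (1 - θ)) = ENNReal.ofReal (t ^ (-θ)) * ENNReal.ofReal t := by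
  rw [← ENNReal.ofReal_mul (by positivity), sub_eq_neg_add, Real.rpow_add ht, Real.rpow_one]

lemma nestedNorm_rearr_le (H : IntervalScheme J I) (f : Ω →ₘ[μ] 𝕜) :
    nestedNorm J I (1 - θ) s c r b q a (rearr f) ≤
      nestedNorm J I (-θ) s c r b q a (K (weakL1 μ 𝕜) (Linf μ 𝕜) f) := by
  have := nestedNorm_le_mul (C := 1) (α := 1 - θ) (β := -θ) (s := s) (c := c) (r := r) (b := b)
    (q := q) (a := a) (φ := rearr f) (ψ := K (weakL1 μ 𝕜) (Linf μ 𝕜) f) H fun t ht => by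
      rw [ofReal_rpow_one_sub θ ht, mul_assoc, ENNReal.coe_one, one_mul]
      exact mul_le_mul_right (ofReal_mul_rearr_le_K f ht) _
  simpa using this

lemma nestedNorm_K_le (H : IntervalScheme J I) (f : Ω →ₘ[μ] 𝕜) :
    nestedNorm J I (-θ) s c r b q a (K (L1 μ 𝕜) (Linf μ 𝕜) f) ≤
      (2 : ℝ≥0) * nestedNorm J I (1 - θ) s c r b q a (maximal f) :=
  nestedNorm_le_mul H fun t ht => by
    rw [ofReal_rpow_one_sub θ ht, mul_assoc, mul_left_comm ((2 : ℝ≥0) : ℝ≥0∞),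
      ofReal_mul_maximal f ht]
    exact mul_le_mul_right (K_L1_Linf_le f ht) _

/-- The space of all `f ∈ A₀ + A₁` at which the nested quasi-norm of the `K`-functional is finite. -/
noncomputable def interpNested {V : Type*} [Add V] (J : ℝ → Set ℝ) (I : ℝ → ℝ → Set ℝ)
    (A₀ A₁ : Space V) (θ : ℝ) (s : ℝ≥0∞) (c : ℝ → ℝ) (r : ℝ≥0∞) (b : ℝ → ℝ) (q : ℝ≥0∞)
    (a : ℝ → ℝ) : Space V where
  carrier := {f | f ∈ sumCarrier A₀ A₁ ∧ nestedNorm J I (-θ) s c r b q a (K A₀ A₁ f) < ∞}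
  qnorm f := nestedNorm J I (-θ) s c r b q a (K A₀ A₁ f)

theorem interpNested_same (H : IntervalScheme J I) (hθ : 0 < θ) (hq : 0 < q) (hr : 0 < r)
    (hs : 0 < s) (ha : IsSV a) (hb : IsSV b) (hc : IsSV c) :
    let S := Space.ofNorm fun f : Ω →ₘ[μ] 𝕜 => nestedNorm J I (1 - θ) s c r b q a (rearr f)
    let D := Space.ofNorm fun f : Ω →ₘ[μ] 𝕜 => nestedNorm J I (1 - θ) s c r b q a (maximal f)
    let X := interpNested J I (L1 μ 𝕜) (Linf μ 𝕜) θ s c r b q a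
    let Y := interpNested J I (weakL1 μ 𝕜) (Linf μ 𝕜) θ s c r b q a
    X.Same Y ∧ Y.Same D ∧ D.Same S := by
  intro S D X Y
  obtain ⟨C, hC⟩ := nestedNorm_average_le (α := 1 - θ) (s := s) (r := r) (q := q) H
    (by linarith) ha hb hc
  have hDS : ∀ f, D.qnorm f ≤ C * S.qnorm f := fun f => hC _ (rearr_antitone f)
  have hSY : ∀ f, S.qnorm f ≤ Y.qnorm f := fun f => nestedNorm_rearr_le H f
  have hYX : ∀ f, Y.qnorm f ≤ X.qnorm f := fun f =>
    nestedNorm_mono H fun t _ => K_weakL1_le_K_L1 f t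
  have hXD : ∀ f, X.qnorm f ≤ (2 : ℝ≥0) * D.qnorm f := fun f => nestedNorm_K_le H f
  have hDY : ∀ f, D.qnorm f ≤ C * Y.qnorm f := fun f =>
    (hDS f).trans (mul_le_mul_right (hSY f) _)
  have hXY : ∀ f, X.qnorm f ≤ (2 * C : ℝ≥0) * Y.qnorm f := fun f => by
    rw [ENNReal.coe_mul, mul_assoc]
    exact (hXD f).trans (mul_le_mul_right (hDY f) _)
  have hSD : ∀ f, S.qnorm f ≤ D.qnorm f := fun f =>
    nestedNorm_mono H fun t ht => rearr_le_maximal f ht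
  -- This supplies the sum-space condition in the definition of the interpolation spaces, which
  -- finiteness of the `f**` quasi-norm does not mention.
  have hmem : ∀ f, D.qnorm f < ∞ → f ∈ sumCarrier (L1 μ 𝕜) (Linf μ 𝕜) := fun f hf => by
    by_contra hn
    exact hf.ne (nestedNorm_top H hq hr hs ha hb hc fun t ht => maximal_eq_top f hn ht)
  have fin : ∀ {x y : ℝ≥0∞} (M : ℝ≥0), x ≤ M * y → y < ∞ → x < ∞ := fun M h hy =>
    h.trans_lt (ENNReal.mul_lt_top ENNReal.coe_lt_top hy)
  refine ⟨⟨⟨?_, 1, ?_⟩, ?_, 2 * C, ?_⟩, ⟨⟨?_, C, ?_⟩, ?_, 2, ?_⟩, ⟨?_, 1, ?_⟩, ?_, C, ?_⟩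
  · exact fun f hf => ⟨sumCarrier_L1_subset hf.1, (hYX f).trans_lt hf.2⟩
  · exact fun f _ => by simpa using hYX f
  · exact fun f hf => ⟨hmem f (fin C (hDY f) hf.2), fin _ (hXY f) hf.2⟩
  · exact fun f _ => hXY f
  · exact fun f hf => fin C (hDY f) hf.2
  · exact fun f _ => hDY f
  · exact fun f hf => ⟨sumCarrier_L1_subset (hmem f hf), (hYX f).trans_lt (fin _ (hXD f) hf)⟩
  · exact fun f _ => (hYX f).trans (hXD f)
  · exact fun f hf => (hSD f).trans_lt hf
  · exact fun f _ => by simpa using hSD f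
  · exact fun f hf => fin C (hDS f) hf
  · exact fun f _ => hDS f

end Comparison

end LorentzKaramata

theorem theorem6p6 {Ω : Type*} [MeasurableSpace Ω] (μ : Measure Ω) [SigmaFinite μ]
    (hμ : Nonatomic μ) (𝕜 : Type*) [RCLike 𝕜]
    (θ : ℝ) (hθ0 : 0 < θ) (hθ1 : θ ≤ 1)
    (p : ℝ≥0∞) (hp : p = 1 / ENNReal.ofReal (1 - θ))
    (q r s : ℝ≥0∞) (hq : 0 < q) (hr : 0 < r) (hs : 0 < s)
    (a b c : ℝ → ℝ) (ha : IsSV a) (hb : IsSV b) (hc : IsSV c) :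
    ((interpRL (L1 μ 𝕜) (Linf μ 𝕜) θ s c r b q a).Same
        (interpRL (weakL1 μ 𝕜) (Linf μ 𝕜) θ s c r b q a) ∧
      (interpRL (weakL1 μ 𝕜) (Linf μ 𝕜) θ s c r b q a).Same (dstarRL μ 𝕜 p s c r b q a) ∧
      (dstarRL μ 𝕜 p s c r b q a).Same (starRL μ 𝕜 p s c r b q a)) ∧
    ((interpLR (L1 μ 𝕜) (Linf μ 𝕜) θ s c r b q a).Same
        (interpLR (weakL1 μ 𝕜) (Linf μ 𝕜) θ s c r b q a) ∧
      (interpLR (weakL1 μ 𝕜) (Linf μ 𝕜) θ s c r b q a).Same (dstarLR μ 𝕜 p s c r b q a) ∧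
      (dstarLR μ 𝕜 p s c r b q a).Same (starLR μ 𝕜 p s c r b q a)) := by
  -- At `θ = 1` this reads `p = 1 / 0 = ∞` and `1 / p = 0`.
  have hp' : (1 / p).toReal = 1 - θ := by
    rw [hp, one_div, one_div, inv_inv, ENNReal.toReal_ofReal (by linarith)]
  refine ⟨?_, ?_⟩
  · have h := interpNested_same (μ := μ) (𝕜 := 𝕜) intervalScheme_RL hθ0 hq hr hs ha hb hc
    rw [← hp'] at h
    -- The concrete spaces unfold definitionally to their nested forms.
    exact h
  · have h := interpNested_same (μ := μ) (𝕜 := 𝕜) intervalScheme_LR hθ0 hq hr hs ha hb hc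
    rw [← hp'] at h
    exact h
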